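/- Let $p,K\ge 0$, $T\ge 1$ be integers, $B\in\mathbb R^{p\times K}$, $F_1,\dots,F_T\in\mathbb R^K$, $\rho\in\mathbb R$, $\delta\ge 0$, and let $\iota,q\in[1,\infty]$ satisfy $1/\iota+1/q=1$. Let $\mathbb P_T=\frac1T\sum_{t=1}^T\delta_{F_t}$ be the empirical law of the factors, and let $\Sigma_e^*=\mathrm{Var}_{\mathbb P^*}(e)$ be the covariance matrix of a square-integrable random vector $e$ in $\mathbb R^p$ defined on a probability space with probability measure $\mathbb P^*$. For probability measures $\mathbb P,\mathbb Q$ on $\mathbb R^K$ put $$D_c(\mathbb P,\mathbb Q)=\inf\bigl\{\mathrm E_\pi\|U-V\|_\iota^2:\ \pi \text{ a law of } (U,V) \text{ on } \mathbb R^K\times\mathbb R^K \text{ with } \pi_U=\mathbb P,\ \pi_V=\mathbb Q\bigr\},$$ and let $\mathcal U_\delta(\mathbb P_T)=\{\mathbb P: D_c(\mathbb P,\mathbb P_T)\le\delta\}$. For $\mathbb P\in\mathcal U_\delta(\mathbb P_T)$ write $\mathrm E_{\mathbb P}(F)$ and $\mathrm{Var}_{\mathbb P}(F)$ for the mean vector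 and the covariance matrix of a random vector $F$ with law $\mathbb P$. Consider the distributionally robust problem $$\min_{w\in\mathbb R^p}\ \max_{\mathbb P\in\mathcal U_\delta(\mathbb P_T)} w^\top\bigl[B\,\mathrm{Var}_{\mathbb P}(F)B^\top+\Sigma_e^*\bigr]w\quad\text{s.t.}\quad w^\top\mathbf 1=1,\ \min_{\mathbb P\in\mathcal U_\delta(\mathbb P_T)}\mathrm E_{\mathbb P}(w^\top BF)\ge\rho, \tag{1}$$ and the non-robust problem $$\min_{w\in\mathbb R^p}\ \Bigl(\sqrt{w^\top B\,\mathrm{Var}_{\mathbb P_T}(F)B^\top w}+\sqrt\delta\,\|B^\top w\|_q\Bigr)^2+w^\top\Sigma_e^*w\quad\text{s.t.}\quad w^\top\mathbf 1=1,\ w^\top B\,\mathrm E_{\mathbb P_T}(F)\ge\rho+\sqrt\delta\,\|B^\top w\|_q. \tag{2}$$ Then every $\mathbb P\in\mathcal U_\delta(\mathbb P_T)$ has finite second moments, the inner maximum and the inner minimum in (1) are attained for every $w\in\mathbb R^p$, and (1) and (2) are equivalent: they have the same feasible set and the same objective function on $\mathbb R^p$, hence the same optimal value ($+\infty$ if the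 feasible set is empty) and the same (possibly empty) set of optimal solutions. -/

import Mathlib

open MeasureTheory
open scoped ENNReal Matrix

noncomputable section

/-- A coupling of `P` and `Q`: a joint probability law with marginals `P` and `Q`. -/
def IsCoupling {X : Type*} [MeasurableSpace X] (P Q : Measure X) (π : Measure (X × X)) : Prop :=
  IsProbabilityMeasure π ∧ π.map Prod.fst = P ∧ π.map Prod.snd = Q

/-- The optimal transport discrepancy `D_c(P, Q)` with cost `c`. -/
def transportCost {X : Type*} [MeasurableSpace X] (c : X → X → ℝ≥0∞) (P Q : Measure X) : ℝ≥0∞ :=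
  ⨅ (π : Measure (X × X)) (_ : IsCoupling P Q π), ∫⁻ z, c z.1 z.2 ∂π

/-- The `ℓ_s` norm of a vector, `1 ≤ s ≤ ∞`. -/
def lpNormVec {n : ℕ} (s : ℝ≥0∞) (x : Fin n → ℝ) : ℝ := ‖WithLp.toLp s x‖

/-- The cost `c(u, v) = ‖u - v‖_s ^ 2`. -/
def sqCost {n : ℕ} (s : ℝ≥0∞) (u v : Fin n → ℝ) : ℝ≥0∞ :=
  ENNReal.ofReal (lpNormVec s (u - v) ^ 2)

/-- The uncertainty set `U_δ(Q)` of all probability laws within discrepancy `δ` of `Q`. -/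
def uncertaintySet {n : ℕ} (s : ℝ≥0∞) (δ : ℝ) (Q : Measure (Fin n → ℝ)) :
    Set (Measure (Fin n → ℝ)) :=
  {P | IsProbabilityMeasure P ∧ transportCost (sqCost s) P Q ≤ ENNReal.ofReal δ}

/-- The empirical law of the sample `F 0, …, F (T - 1)`. -/
def empiricalLaw {n T : ℕ} (F : Fin T → Fin n → ℝ) : Measure (Fin n → ℝ) :=
  (T : ℝ≥0∞)⁻¹ • ∑ t, Measure.dirac (F t)

/-- The mean vector of a random vector `X` under `P`. -/
def meanVec {Ω : Type*} [MeasurableSpace Ω] {n : ℕ} (P : Measure Ω) (X : Ω → Fin n → ℝ) :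
    Fin n → ℝ :=
  fun i => ∫ ω, X ω i ∂P

/-- The covariance matrix of a random vector `X` under `P`. -/
def covMat {Ω : Type*} [MeasurableSpace Ω] {n : ℕ} (P : Measure Ω) (X : Ω → Fin n → ℝ) :
    Matrix (Fin n) (Fin n) ℝ :=
  Matrix.of fun i j => ProbabilityTheory.covariance (fun ω => X ω i) (fun ω => X ω j) P

/-- A constrained minimization problem. The objective may take infinite values. -/
structure MinProblem (X : Type*) where
  feasible : Set X
  objective : X → EReal

/-- The optimal value (`⊤` if there is no feasible point). -/
def MinProblem.value {X : Type*} (M : MinProblem X) : EReal := ⨅ x ∈ M.feasible, M.objective x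

/-- The set of optimal solutions. -/
def MinProblem.solutions {X : Type*} (M : MinProblem X) : Set X :=
  {x | x ∈ M.feasible ∧ ∀ y ∈ M.feasible, M.objective x ≤ M.objective y}

/-- The risk `wᵀ [B Var_P(F) Bᵀ + Σ] w` when the factor has law `P`. -/
def portfolioRisk {p K : ℕ} (B : Matrix (Fin p) (Fin K) ℝ) (S : Matrix (Fin p) (Fin p) ℝ)
    (w : Fin p → ℝ) (P : Measure (Fin K → ℝ)) : ℝ :=
  w ⬝ᵥ ((B * covMat P id * Bᵀ + S) *ᵥ w)

/-- The expected return `E_P(wᵀ B F)` when the factor has law `P`. -/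
def portfolioReturn {p K : ℕ} (B : Matrix (Fin p) (Fin K) ℝ)
    (w : Fin p → ℝ) (P : Measure (Fin K → ℝ)) : ℝ :=
  ∫ x, w ⬝ᵥ (B *ᵥ x) ∂P

/-- The distributionally robust problem: minimize `max_{P ∈ U} wᵀ [B Var_P(F) Bᵀ + Σ] w`
subject to `wᵀ 1 = 1` and `min_{P ∈ U} E_P(wᵀ B F) ≥ ρ`. -/
def robustProblem {p K : ℕ} (B : Matrix (Fin p) (Fin K) ℝ) (S : Matrix (Fin p) (Fin p) ℝ)
    (ρ : ℝ) (U : Set (Measure (Fin K → ℝ))) : MinProblem (Fin p → ℝ) where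
  feasible := {w | w ⬝ᵥ 1 = 1 ∧ (ρ : EReal) ≤ ⨅ P ∈ U, (portfolioReturn B w P : EReal)}
  objective w := ⨆ P ∈ U, (portfolioRisk B S w P : EReal)

/-- The regularized problem: minimize `(√(wᵀ B Var_Q(F) Bᵀ w) + √δ ‖Bᵀ w‖_q)² + wᵀ Σ w`
subject to `wᵀ 1 = 1` and `wᵀ B E_Q(F) ≥ ρ + √δ ‖Bᵀ w‖_q`. -/
def regularizedProblem {p K : ℕ} (B : Matrix (Fin p) (Fin K) ℝ) (S : Matrix (Fin p) (Fin p) ℝ)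
    (q : ℝ≥0∞) (δ ρ : ℝ) (Q : Measure (Fin K → ℝ)) : MinProblem (Fin p → ℝ) where
  feasible := {w | w ⬝ᵥ 1 = 1 ∧
    w ⬝ᵥ (B *ᵥ meanVec Q id) ≥ ρ + √δ * lpNormVec q (Bᵀ *ᵥ w)}
  objective w := (((√(w ⬝ᵥ ((B * covMat Q id * Bᵀ) *ᵥ w)) + √δ * lpNormVec q (Bᵀ *ᵥ w)) ^ 2
    + w ⬝ᵥ (S *ᵥ w) : ℝ) : EReal)

end

/-! Both problems see a factor law only through the scalar projection `β ⬝ᵥ x`, where `β = Bᵀ *ᵥ w`,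
so it suffices to find the extreme variance and mean of this projection over the transport ball.

Upper bounds: under a coupling `(U, V)` write `β ⬝ᵥ U = β ⬝ᵥ V + β ⬝ᵥ (U - V)`. By Hölder the second
term has second moment at most `‖β‖_q²` times the cost, so the standard deviation grows by at most
`√δ ‖β‖_q` (Minkowski) and the mean moves by at most that much (`IsCoupling.moment_bounds`).

Sharpness: all mass is displaced along one vector `v` that is extremal in Hölder's inequality
(`map_add_smul_mem_uncertaintySet`); the scalar amount is chosen to make the remaining inequality an
equality (`exists_integral_eq`, `exists_variance_eq`). -/

open ProbabilityTheory

/-! ### Duality of the `ℓ_r` and `ℓ_s` norms. -/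

section LpNorm

variable {n : ℕ} {r s : ℝ≥0∞}

lemma lpNormVec_smul [Fact (1 ≤ r)] (c : ℝ) (x : Fin n → ℝ) :
    lpNormVec r (c • x) = |c| * lpNormVec r x := by
  simp [lpNormVec, WithLp.toLp_smul, norm_smul]

lemma lpNormVec_nonneg [Fact (1 ≤ r)] (x : Fin n → ℝ) : 0 ≤ lpNormVec r x :=
  norm_nonneg _

lemma lpNormVec_one (x : Fin n → ℝ) : lpNormVec 1 x = ∑ i, |x i| := by
  simp [lpNormVec, PiLp.norm_eq_of_L1]

lemma lpNormVec_top (x : Fin n → ℝ) : lpNormVec ∞ x = ‖x‖ := by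
  simp [lpNormVec]

lemma lpNormVec_eq_sum (hr : 0 < r.toReal) (x : Fin n → ℝ) :
    lpNormVec r x = (∑ i, |x i| ^ r.toReal) ^ (1 / r.toReal) := by
  simp [lpNormVec, PiLp.norm_eq_sum hr]

lemma abs_dotProduct_le_one_top (x y : Fin n → ℝ) :
    |x ⬝ᵥ y| ≤ lpNormVec 1 x * lpNormVec ∞ y := by
  rw [lpNormVec_one, lpNormVec_top, Finset.sum_mul]
  refine (Finset.abs_sum_le_sum_abs _ _).trans (Finset.sum_le_sum fun i _ => ?_)
  rw [abs_mul]
  exact mul_le_mul_of_nonneg_left (norm_le_pi_norm y i) (abs_nonneg _)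

/-- The finite-dimensional Hölder inequality. -/
lemma abs_dotProduct_le [h : r.HolderConjugate s] (x y : Fin n → ℝ) :
    |x ⬝ᵥ y| ≤ lpNormVec r x * lpNormVec s y := by
  by_cases hr : r = ∞
  · subst hr
    obtain rfl : s = 1 := ENNReal.HolderConjugate.unique ∞ s 1
    rw [dotProduct_comm, mul_comm]
    exact abs_dotProduct_le_one_top y x
  by_cases hs : s = ∞
  · subst hs
    obtain rfl : r = 1 := ENNReal.HolderConjugate.unique ∞ r 1
    exact abs_dotProduct_le_one_top x y
  have hpq := ENNReal.HolderConjugate.toReal_of_ne_top hr hs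
  rw [lpNormVec_eq_sum hpq.pos, lpNormVec_eq_sum hpq.symm.pos]
  refine (Finset.abs_sum_le_sum_abs _ _).trans ?_
  simpa [abs_mul] using
    Real.inner_le_Lp_mul_Lq Finset.univ (fun i => |x i|) (fun i => |y i|) hpq

/-- The Hölder inequality is sharp: the `ℓ_r` norm is attained on the unit ball of `ℓ_s`. -/
lemma exists_dotProduct_eq_lpNormVec [h : r.HolderConjugate s] (x : Fin n → ℝ) :
    ∃ v, lpNormVec s v ≤ 1 ∧ x ⬝ᵥ v = lpNormVec r x := by
  have sgn (a : ℝ) : a * SignType.sign a = |a| := by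
    rw [mul_comm, sign_mul_self]
  have sgn_le (a : ℝ) : |((SignType.sign a : SignType) : ℝ)| ≤ 1 := by
    rcases lt_trichotomy a 0 with h | h | h <;> simp [h]
  by_cases hr : r = ∞
  · subst hr
    obtain rfl : s = 1 := ENNReal.HolderConjugate.unique ∞ s 1
    rcases isEmpty_or_nonempty (Fin n) with hn | hn
    · exact ⟨0, by simp [lpNormVec_one], by simp [lpNormVec_top, Subsingleton.elim x 0]⟩
    obtain ⟨i, hi⟩ := Finite.exists_max fun i => |x i|
    refine ⟨Pi.single i (SignType.sign (x i) : ℝ), ?_, ?_⟩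
    · rw [lpNormVec_one, Finset.sum_eq_single i (fun j _ hj => by simp [hj]) (by simp)]
      simpa using sgn_le (x i)
    · rw [dotProduct_single, sgn, lpNormVec_top]
      exact le_antisymm (norm_le_pi_norm x i) ((pi_norm_le_iff_of_nonneg (abs_nonneg _)).2 hi)
  by_cases hs : s = ∞
  · subst hs
    obtain rfl : r = 1 := ENNReal.HolderConjugate.unique ∞ r 1
    refine ⟨fun i => (SignType.sign (x i) : ℝ), ?_, ?_⟩
    · rw [lpNormVec_top, pi_norm_le_iff_of_nonneg zero_le_one]
      exact fun i => sgn_le (x i)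
    · rw [lpNormVec_one]
      exact Finset.sum_congr rfl fun i _ => sgn (x i)
  have hpq := ENNReal.HolderConjugate.toReal_of_ne_top hr hs
  -- An optimal nonnegative dual vector for the absolute values of `x`; restoring the signs of `x`
  -- makes it optimal for `x` itself.
  obtain ⟨g, hg, hxg⟩ := (NNReal.isGreatest_Lp Finset.univ (fun i => ‖x i‖₊) hpq).1
  refine ⟨fun i => SignType.sign (x i) * g i, ?_, ?_⟩
  · rw [lpNormVec_eq_sum hpq.symm.pos]
    refine Real.rpow_le_one (by positivity) (le_trans (Finset.sum_le_sum fun i _ => ?_)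
      (show (∑ i, (g i : ℝ) ^ s.toReal) ≤ 1 by exact_mod_cast hg)) (by positivity)
    refine Real.rpow_le_rpow (abs_nonneg _) ?_ hpq.symm.nonneg
    rw [abs_mul, NNReal.abs_eq]
    exact mul_le_of_le_one_left (g i).2 (sgn_le _)
  · have := congrArg NNReal.toReal hxg
    push_cast at this
    rw [lpNormVec_eq_sum hpq.pos]
    simp only [← Real.norm_eq_abs]
    rw [← this]
    exact Finset.sum_congr rfl fun i _ => by rw [← mul_assoc, sgn, Real.norm_eq_abs]

end LpNorm

/-! ### Second-moment inequalities and linear functionals of random vectors. -/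

section Moments

variable {Ω : Type*} [MeasurableSpace Ω] {μ : Measure Ω}

lemma memLp_two_and_integral_sq_le {f : Ω → ℝ} (hf : AEStronglyMeasurable f μ) {c : ℝ}
    (hc : 0 ≤ c) (h : ∫⁻ ω, ENNReal.ofReal (f ω ^ 2) ∂μ ≤ ENNReal.ofReal c) :
    MemLp f 2 μ ∧ ∫ ω, f ω ^ 2 ∂μ ≤ c := by
  constructor
  · rw [memLp_two_iff_integrable_sq hf]
    refine ⟨hf.pow 2, ?_⟩
    rw [hasFiniteIntegral_iff_ofReal (.of_forall fun ω => sq_nonneg _)]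
    exact h.trans_lt ENNReal.ofReal_lt_top
  · rw [integral_eq_lintegral_of_nonneg_ae (.of_forall fun ω => sq_nonneg _) (hf.pow 2)]
    exact ENNReal.toReal_le_of_le_ofReal hc h

/-- The variance of `t • X + Y` is a nonnegative quadratic in `t`, so its discriminant is
nonpositive. -/
lemma covariance_sq_le [IsProbabilityMeasure μ] {X Y : Ω → ℝ} (hX : MemLp X 2 μ)
    (hY : MemLp Y 2 μ) : cov[X, Y; μ] ^ 2 ≤ Var[X; μ] * Var[Y; μ] := by
  have h (t : ℝ) : 0 ≤ Var[X; μ] * (t * t) + (2 * cov[X, Y; μ]) * t + Var[Y; μ] := by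
    have := variance_nonneg (t • X + Y) μ
    rw [variance_add (hX.const_smul t) hY, variance_smul, covariance_smul_left] at this
    linarith
  have := discrim_le_zero h
  rw [discrim] at this
  linarith

/-- Minkowski's inequality for standard deviations. -/
lemma variance_add_le [IsProbabilityMeasure μ] {X Y : Ω → ℝ} (hX : MemLp X 2 μ)
    (hY : MemLp Y 2 μ) : Var[X + Y; μ] ≤ (√Var[X; μ] + √Var[Y; μ]) ^ 2 := by
  have h : cov[X, Y; μ] ≤ √Var[X; μ] * √Var[Y; μ] := by
    rw [← Real.sqrt_mul (variance_nonneg _ _)]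
    exact Real.le_sqrt_of_sq_le (covariance_sq_le hX hY)
  rw [variance_add hX hY, add_sq, Real.sq_sqrt (variance_nonneg _ _),
    Real.sq_sqrt (variance_nonneg _ _)]
  linarith

lemma abs_integral_le_sqrt [IsProbabilityMeasure μ] {X : Ω → ℝ} (hX : MemLp X 2 μ) :
    |∫ ω, X ω ∂μ| ≤ √(∫ ω, X ω ^ 2 ∂μ) := by
  have := variance_nonneg X μ
  rw [variance_eq_sub hX] at this
  exact Real.abs_le_sqrt (by simpa using this)

lemma variance_dotProduct [IsFiniteMeasure μ] {n : ℕ} {X : Ω → Fin n → ℝ}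
    (hX : ∀ i, MemLp (fun ω => X ω i) 2 μ) (β : Fin n → ℝ) :
    Var[fun ω => β ⬝ᵥ X ω; μ] = β ⬝ᵥ (covMat μ X *ᵥ β) := by
  simp only [dotProduct, Matrix.mulVec, covMat, Matrix.of_apply]
  rw [variance_fun_sum fun i => (hX i).const_mul (β i)]
  simp_rw [covariance_const_mul_left, covariance_const_mul_right, Finset.mul_sum]
  exact Finset.sum_congr rfl fun i _ => Finset.sum_congr rfl fun j _ => by ring

lemma memLp_dotProduct {n : ℕ} {X : Ω → Fin n → ℝ}
    (hX : ∀ i, MemLp (fun ω => X ω i) 2 μ) (β : Fin n → ℝ) :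
    MemLp (fun ω => β ⬝ᵥ X ω) 2 μ :=
  memLp_finsetSum _ fun i _ => (hX i).const_mul (β i)

lemma integral_dotProduct [IsFiniteMeasure μ] {n : ℕ} {X : Ω → Fin n → ℝ}
    (hX : ∀ i, MemLp (fun ω => X ω i) 2 μ) (β : Fin n → ℝ) :
    ∫ ω, β ⬝ᵥ X ω ∂μ = β ⬝ᵥ meanVec μ X := by
  simp only [dotProduct, meanVec]
  rw [integral_finsetSum _ fun i _ => ((hX i).integrable one_le_two).const_mul (β i)]
  simp_rw [integral_const_mul]

end Moments

/-! ### The empirical law has finite second moments. -/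

section EmpiricalLaw

variable {n T : ℕ} (F : Fin T → Fin n → ℝ)

lemma isProbabilityMeasure_empiricalLaw (hT : 0 < T) : IsProbabilityMeasure (empiricalLaw F) := by
  constructor
  simp [empiricalLaw, ENNReal.inv_mul_cancel, hT.ne']

lemma memLp_empiricalLaw (hT : 0 < T) (k : Fin n) :
    MemLp (fun x : Fin n → ℝ => x k) 2 (empiricalLaw F) := by
  have hm : Measurable fun x : Fin n → ℝ => x k := measurable_pi_apply k
  rw [memLp_two_iff_integrable_sq hm.aestronglyMeasurable]
  refine Integrable.smul_measure (integrable_finsetSum_measure.2 fun t _ => ?_)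
    (by simp [hT.ne'])
  exact integrable_dirac (by simp)

end EmpiricalLaw

/-! ### Extreme variance and mean over a transport ball. -/

section Transport

variable {n : ℕ} {s q : ℝ≥0∞} {P Q : Measure (Fin n → ℝ)}

lemma measurable_dotProduct_const (β : Fin n → ℝ) : Measurable fun x : Fin n → ℝ => β ⬝ᵥ x := by
  unfold dotProduct
  fun_prop

/-- The displacement `Y` has second moment at most `lpNormVec q β ^ 2 * c` by Hölder; this controls
both its standard deviation and its mean. -/
lemma IsCoupling.moment_bounds [q.HolderConjugate s] {π : Measure ((Fin n → ℝ) × (Fin n → ℝ))}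
    (hπ : IsCoupling P Q π) (hQ : ∀ k, MemLp (fun x : Fin n → ℝ => x k) 2 Q) {c : ℝ} (hc : 0 ≤ c)
    (hcost : ∫⁻ z, sqCost s z.1 z.2 ∂π ≤ ENNReal.ofReal c) (β : Fin n → ℝ) :
    MemLp (fun x => β ⬝ᵥ x) 2 P ∧
    Var[fun x => β ⬝ᵥ x; P] ≤ (√Var[fun x => β ⬝ᵥ x; Q] + √c * lpNormVec q β) ^ 2 ∧
    |∫ x, β ⬝ᵥ x ∂P - ∫ x, β ⬝ᵥ x ∂Q| ≤ √c * lpNormVec q β := by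
  obtain ⟨_, rfl, rfl⟩ := hπ
  have : Fact (1 ≤ q) := ⟨ENNReal.HolderConjugate.one_le q s⟩
  have hm := measurable_dotProduct_const β
  have hN := lpNormVec_nonneg (r := q) β
  have hb : √(lpNormVec q β ^ 2 * c) = √c * lpNormVec q β := by
    rw [Real.sqrt_mul (sq_nonneg _), Real.sqrt_sq hN, mul_comm]
  set X : (Fin n → ℝ) × (Fin n → ℝ) → ℝ := fun z => β ⬝ᵥ z.2
  set Y : (Fin n → ℝ) × (Fin n → ℝ) → ℝ := fun z => β ⬝ᵥ (z.1 - z.2)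
  have hYm : Measurable Y := hm.comp (measurable_fst.sub measurable_snd)
  have hXY : X + Y = fun z => β ⬝ᵥ z.1 := by
    ext z
    simp [X, Y, dotProduct_sub]
  have hXL : MemLp X 2 π :=
    (memLp_map_measure_iff hm.aestronglyMeasurable measurable_snd.aemeasurable).1
      (memLp_dotProduct hQ β)
  obtain ⟨hYL, hYsq⟩ : MemLp Y 2 π ∧ ∫ z, Y z ^ 2 ∂π ≤ lpNormVec q β ^ 2 * c := by
    refine memLp_two_and_integral_sq_le hYm.aestronglyMeasurable (by positivity) ?_
    calc ∫⁻ z, ENNReal.ofReal (Y z ^ 2) ∂π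
        ≤ ∫⁻ z, ENNReal.ofReal (lpNormVec q β ^ 2) * sqCost s z.1 z.2 ∂π := by
          refine lintegral_mono fun z => ?_
          rw [sqCost, ← ENNReal.ofReal_mul (sq_nonneg _), ← mul_pow, ← sq_abs]
          exact ENNReal.ofReal_le_ofReal
            (pow_le_pow_left₀ (abs_nonneg _) (abs_dotProduct_le β _) 2)
      _ = ENNReal.ofReal (lpNormVec q β ^ 2) * ∫⁻ z, sqCost s z.1 z.2 ∂π :=
          lintegral_const_mul' _ _ ENNReal.ofReal_ne_top
      _ ≤ _ := by
          rw [ENNReal.ofReal_mul (sq_nonneg _)]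
          gcongr
  refine ⟨?_, ?_, ?_⟩
  · rw [memLp_map_measure_iff hm.aestronglyMeasurable measurable_fst.aemeasurable]
    change MemLp (fun z => β ⬝ᵥ z.1) 2 π
    exact hXY ▸ hXL.add hYL
  · rw [variance_map hm.aemeasurable measurable_fst.aemeasurable,
      variance_map hm.aemeasurable measurable_snd.aemeasurable]
    change Var[fun z => β ⬝ᵥ z.1; π] ≤ (√Var[X; π] + _) ^ 2
    rw [← hXY, ← hb]
    refine (variance_add_le hXL hYL).trans ?_
    gcongr
    exact (variance_le_expectation_sq hYm.aestronglyMeasurable).trans hYsq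
  · rw [integral_map measurable_fst.aemeasurable hm.aestronglyMeasurable,
      integral_map measurable_snd.aemeasurable hm.aestronglyMeasurable, ← hb]
    change |∫ z, (fun z => β ⬝ᵥ z.1) z ∂π - ∫ z, X z ∂π| ≤ _
    rw [← hXY, integral_add' (hXL.integrable one_le_two) (hYL.integrable one_le_two),
      add_sub_cancel_left]
    exact (abs_integral_le_sqrt hYL).trans (Real.sqrt_le_sqrt hYsq)

/-- An optimal coupling is never needed: every budget `c > δ` is met by some coupling, and the sharp
bounds follow by letting `c` decrease to `δ`. -/
lemma exists_coupling_of_mem_uncertaintySet {δ c : ℝ} (hP : P ∈ uncertaintySet s δ Q)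
    (hδ : 0 ≤ δ) (hc : δ < c) :
    ∃ π, IsCoupling P Q π ∧ ∫⁻ z, sqCost s z.1 z.2 ∂π ≤ ENNReal.ofReal c := by
  have h : transportCost (sqCost s) P Q < ENNReal.ofReal c :=
    hP.2.trans_lt ((ENNReal.ofReal_lt_ofReal_iff_of_nonneg hδ).2 hc)
  simp only [transportCost, iInf_lt_iff] at h
  obtain ⟨π, hπ, h⟩ := h
  exact ⟨π, hπ, h.le⟩

variable {δ : ℝ} (hδ : 0 ≤ δ) (hQ : ∀ k, MemLp (fun x : Fin n → ℝ => x k) 2 Q)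
include hδ hQ

lemma memLp_of_mem_uncertaintySet [q.HolderConjugate s] (hP : P ∈ uncertaintySet s δ Q)
    (k : Fin n) : MemLp (fun x : Fin n → ℝ => x k) 2 P := by
  obtain ⟨π, hπ, hcost⟩ := exists_coupling_of_mem_uncertaintySet hP hδ (lt_add_one δ)
  simpa using (hπ.moment_bounds (q := q) hQ (by linarith) hcost (Pi.single k 1)).1

lemma variance_le_of_mem_uncertaintySet [q.HolderConjugate s] (hP : P ∈ uncertaintySet s δ Q)
    (β : Fin n → ℝ) :
    Var[fun x => β ⬝ᵥ x; P] ≤ (√Var[fun x => β ⬝ᵥ x; Q] + √δ * lpNormVec q β) ^ 2 := by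
  have hcont : Continuous fun c : ℝ =>
      (√Var[fun x => β ⬝ᵥ x; Q] + √c * lpNormVec q β) ^ 2 := by fun_prop
  refine ge_of_tendsto ((hcont.tendsto δ).mono_left (nhdsWithin_le_nhds (s := .Ioi δ))) ?_
  filter_upwards [self_mem_nhdsWithin] with c hc
  obtain ⟨π, hπ, hcost⟩ := exists_coupling_of_mem_uncertaintySet hP hδ hc
  exact (hπ.moment_bounds hQ (hδ.trans (le_of_lt hc)) hcost β).2.1

lemma le_integral_of_mem_uncertaintySet [q.HolderConjugate s] (hP : P ∈ uncertaintySet s δ Q)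
    (β : Fin n → ℝ) :
    ∫ x, β ⬝ᵥ x ∂Q - √δ * lpNormVec q β ≤ ∫ x, β ⬝ᵥ x ∂P := by
  have hcont : Continuous fun c : ℝ => ∫ x, β ⬝ᵥ x ∂Q - √c * lpNormVec q β := by fun_prop
  refine le_of_tendsto ((hcont.tendsto δ).mono_left (nhdsWithin_le_nhds (s := .Ioi δ))) ?_
  filter_upwards [self_mem_nhdsWithin] with c hc
  obtain ⟨π, hπ, hcost⟩ := exists_coupling_of_mem_uncertaintySet hP hδ hc
  have := (abs_le.1 (hπ.moment_bounds (q := q) hQ (hδ.trans (le_of_lt hc)) hcost β).2.2).1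
  linarith

omit hQ in
/-- Moving mass in a fixed direction `v` of the unit ball by a random amount `√δ * A`, where
`E (A ^ 2) ≤ 1`, stays within the uncertainty set. -/
lemma map_add_smul_mem_uncertaintySet [Fact (1 ≤ s)] {Ω : Type*} [MeasurableSpace Ω]
    {μ : Measure Ω} [IsProbabilityMeasure μ] {X : Ω → Fin n → ℝ} (hX : Measurable X)
    {A : Ω → ℝ} (hA : Measurable A) (hXQ : μ.map X = Q)
    (hA1 : ∫⁻ ω, ENNReal.ofReal (A ω ^ 2) ∂μ ≤ 1) {v : Fin n → ℝ} (hv : lpNormVec s v ≤ 1) :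
    μ.map (fun ω => X ω + (√δ * A ω) • v) ∈ uncertaintySet s δ Q := by
  set Z : Ω → Fin n → ℝ := fun ω => X ω + (√δ * A ω) • v
  have hZm : Measurable Z := by fun_prop
  have hv0 := lpNormVec_nonneg (r := s) v
  refine ⟨Measure.isProbabilityMeasure_map hZm.aemeasurable, ?_⟩
  have hπ : IsCoupling (μ.map Z) Q (μ.map fun ω => (Z ω, X ω)) := by
    refine ⟨Measure.isProbabilityMeasure_map (hZm.prodMk hX).aemeasurable, ?_, ?_⟩
    · rw [Measure.map_map measurable_fst (hZm.prodMk hX)]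
      rfl
    · rw [Measure.map_map measurable_snd (hZm.prodMk hX)]
      exact hXQ
  refine (iInf₂_le _ hπ).trans ?_
  -- Only this inequality is needed, and it spares a proof that the cost is measurable.
  refine (lintegral_map_le _ _).trans ?_
  calc ∫⁻ ω, sqCost s (Z ω) (X ω) ∂μ
      ≤ ∫⁻ ω, ENNReal.ofReal δ * ENNReal.ofReal (A ω ^ 2) ∂μ := by
        refine lintegral_mono fun ω => ?_
        rw [sqCost, ← ENNReal.ofReal_mul hδ, add_sub_cancel_left, lpNormVec_smul, mul_pow, sq_abs,
          mul_pow, Real.sq_sqrt hδ]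
        exact ENNReal.ofReal_le_ofReal
          (mul_le_of_le_one_right (by positivity) (pow_le_one₀ hv0 hv))
    _ = ENNReal.ofReal δ * ∫⁻ ω, ENNReal.ofReal (A ω ^ 2) ∂μ :=
        lintegral_const_mul' _ _ ENNReal.ofReal_ne_top
    _ ≤ _ := mul_le_of_le_one_right' hA1

/-- The worst-case mean over the uncertainty set is attained by a translation. -/
lemma exists_integral_eq [IsProbabilityMeasure Q] [q.HolderConjugate s] (β : Fin n → ℝ) :
    ∃ P ∈ uncertaintySet s δ Q, ∫ x, β ⬝ᵥ x ∂P = ∫ x, β ⬝ᵥ x ∂Q - √δ * lpNormVec q β := by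
  have : Fact (1 ≤ s) := ⟨ENNReal.HolderConjugate.one_le s q⟩
  obtain ⟨v, hv, hβv⟩ := exists_dotProduct_eq_lpNormVec (r := q) (s := s) β
  have hm := measurable_dotProduct_const β
  refine ⟨_, map_add_smul_mem_uncertaintySet (μ := Q) hδ measurable_id
    (measurable_const (a := (-1 : ℝ))) Measure.map_id (by simp) hv, ?_⟩
  rw [integral_map (by fun_prop) hm.aestronglyMeasurable]
  simp only [dotProduct_add, dotProduct_smul, hβv, id, smul_eq_mul]
  rw [integral_add ((memLp_dotProduct hQ β).integrable one_le_two) (integrable_const _)]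
  simp
  ring

/-- The worst-case variance over the uncertainty set is attained: by a dilation along the
centred projection if that projection is not constant, and by random signs if it is. -/
lemma exists_variance_eq [IsProbabilityMeasure Q] [q.HolderConjugate s] (β : Fin n → ℝ) :
    ∃ P ∈ uncertaintySet s δ Q,
      Var[fun x => β ⬝ᵥ x; P] = (√Var[fun x => β ⬝ᵥ x; Q] + √δ * lpNormVec q β) ^ 2 := by
  have : Fact (1 ≤ s) := ⟨ENNReal.HolderConjugate.one_le s q⟩
  obtain ⟨v, hv, hβv⟩ := exists_dotProduct_eq_lpNormVec (r := q) (s := s) β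
  have hm := measurable_dotProduct_const β
  have hL := memLp_dotProduct hQ β
  rcases (variance_nonneg (fun x => β ⬝ᵥ x) Q).eq_or_lt with h0 | hpos
  -- With no variance to dilate, an independent fair sign `±1` supplies the displacement: its mean
  -- is zero, so its whole second moment becomes variance.
  · set ν : Measure ℝ := (2⁻¹ : ℝ≥0∞) • (Measure.dirac 1 + Measure.dirac (-1)) with hν
    have : IsProbabilityMeasure ν := ⟨by simp [ν, ENNReal.inv_two_add_inv_two]⟩
    have hνint (f : ℝ → ℝ) : ∫ x, f x ∂ν = (f 1 + f (-1)) / 2 := by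
      rw [hν, integral_smul_measure,
        integral_add_measure (integrable_dirac (by simp)) (integrable_dirac (by simp))]
      simp
      ring
    refine ⟨_, map_add_smul_mem_uncertaintySet (μ := Q.prod ν) hδ measurable_fst
      measurable_snd ?_ ?_ hv, ?_⟩
    · simp
    · rw [lintegral_prod _ (by fun_prop)]
      simp [hν, ENNReal.inv_two_add_inv_two]
    · rw [variance_map hm.aemeasurable (by fun_prop), ← h0]
      have hY : MemLp (fun a : ℝ => √δ * lpNormVec q β * a) 2 ν := by
        refine .const_mul ?_ _
        rw [memLp_two_iff_integrable_sq (by fun_prop)]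
        exact ((integrable_dirac (by simp)).add_measure (integrable_dirac (by simp))).smul_measure
          (by simp)
      have hfun : ((fun x => β ⬝ᵥ x) ∘ fun z : (Fin n → ℝ) × ℝ => z.1 + (√δ * z.2) • v) =
          fun z => (β ⬝ᵥ z.1) + √δ * lpNormVec q β * z.2 := by
        ext z
        simp [dotProduct_add, hβv]
        ring
      rw [hfun, variance_add_prod hL hY, ← h0, variance_const_mul,
        variance_eq_integral aemeasurable_id', hνint]
      simp [hνint]
  · set σ := √Var[fun x => β ⬝ᵥ x; Q]
    have hσpos : 0 < σ := Real.sqrt_pos.2 hpos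
    have hσsq : σ ^ 2 = Var[fun x => β ⬝ᵥ x; Q] := Real.sq_sqrt hpos.le
    set m := ∫ x, β ⬝ᵥ x ∂Q
    -- The standardized projection has `E (A ^ 2) = 1` and is perfectly correlated with `β ⬝ᵥ x`,
    -- the equality case of Minkowski.
    refine ⟨_, map_add_smul_mem_uncertaintySet (μ := Q) (A := fun x => (β ⬝ᵥ x - m) / σ) hδ
      measurable_id (by fun_prop) Measure.map_id (le_of_eq ?_) hv, ?_⟩
    · simp_rw [div_pow, div_eq_mul_inv, ENNReal.ofReal_mul (sq_nonneg _)]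
      rw [lintegral_mul_const' _ _ ENNReal.ofReal_ne_top, ← evariance_eq_lintegral_ofReal,
        ← ofReal_variance hL, ← hσsq, ← ENNReal.ofReal_mul (sq_nonneg _),
        mul_inv_cancel₀ (by positivity), ENNReal.ofReal_one]
    · rw [variance_map hm.aemeasurable (by fun_prop)]
      have hfun : ((fun x => β ⬝ᵥ x) ∘ fun x => id x + (√δ * ((β ⬝ᵥ x - m) / σ)) • v) =
          fun x => (1 + √δ * lpNormVec q β / σ) * (β ⬝ᵥ x) + -(√δ * lpNormVec q β / σ * m) := by
        ext x
        simp [dotProduct_add, hβv]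
        ring
      rw [hfun, variance_add_const (by fun_prop), variance_const_mul, ← hσsq]
      field_simp

end Transport

/-! ### Reduction of risk and return to the projection along `Bᵀ *ᵥ w`. -/

section Portfolio

variable {p K : ℕ} (B : Matrix (Fin p) (Fin K) ℝ)

lemma dotProduct_mulVec_eq (w : Fin p → ℝ) (x : Fin K → ℝ) :
    w ⬝ᵥ (B *ᵥ x) = (Bᵀ *ᵥ w) ⬝ᵥ x := by
  rw [Matrix.dotProduct_mulVec, Matrix.mulVec_transpose]

lemma dotProduct_conj_covMat {P : Measure (Fin K → ℝ)} [IsFiniteMeasure P]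
    (hP : ∀ k, MemLp (fun x : Fin K → ℝ => x k) 2 P) (w : Fin p → ℝ) :
    w ⬝ᵥ ((B * covMat P id * Bᵀ) *ᵥ w) = Var[fun x => (Bᵀ *ᵥ w) ⬝ᵥ x; P] := by
  rw [← Matrix.mulVec_mulVec, ← Matrix.mulVec_mulVec, dotProduct_mulVec_eq]
  exact (variance_dotProduct (X := id) hP _).symm

lemma portfolioRisk_eq {P : Measure (Fin K → ℝ)} [IsFiniteMeasure P]
    (hP : ∀ k, MemLp (fun x : Fin K → ℝ => x k) 2 P) (S : Matrix (Fin p) (Fin p) ℝ)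
    (w : Fin p → ℝ) :
    portfolioRisk B S w P = Var[fun x => (Bᵀ *ᵥ w) ⬝ᵥ x; P] + w ⬝ᵥ (S *ᵥ w) := by
  rw [portfolioRisk, Matrix.add_mulVec, dotProduct_add, dotProduct_conj_covMat B hP]

lemma portfolioReturn_eq (P : Measure (Fin K → ℝ)) (w : Fin p → ℝ) :
    portfolioReturn B w P = ∫ x, (Bᵀ *ᵥ w) ⬝ᵥ x ∂P := by
  simp only [portfolioReturn, dotProduct_mulVec_eq]

end Portfolio

theorem theorem1 {Ω : Type*} [MeasurableSpace Ω] (Pstar : Measure Ω) [IsProbabilityMeasure Pstar]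
    {p K T : ℕ} (hT : 0 < T)
    (B : Matrix (Fin p) (Fin K) ℝ) (F : Fin T → Fin K → ℝ)
    (e : Ω → Fin p → ℝ) (he : ∀ i, MemLp (fun ω => e ω i) 2 Pstar)
    (ι q : ℝ≥0∞) (hι : 1 ≤ ι) (hιq : 1 / ι + 1 / q = 1)
    (δ ρ : ℝ) (hδ : 0 ≤ δ) :
    let U := uncertaintySet ι δ (empiricalLaw F)
    let primal := robustProblem B (covMat Pstar e) ρ U
    let dual := regularizedProblem B (covMat Pstar e) q δ ρ (empiricalLaw F)
    -- all means and variances in the robust problem are finite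
    (∀ P ∈ U, ∀ k, MemLp (fun x : Fin K → ℝ => x k) 2 P) ∧
    -- the inner maximum and minimum are attained
    (∀ w, (∃ P ∈ U, IsMaxOn (portfolioRisk B (covMat Pstar e) w) U P) ∧
      (∃ P ∈ U, IsMinOn (portfolioReturn B w) U P)) ∧
    -- the two problems are equivalent
    primal.feasible = dual.feasible ∧
    (∀ w, primal.objective w = dual.objective w) ∧
    primal.value = dual.value ∧
    primal.solutions = dual.solutions := by
  intro U primal dual
  have := isProbabilityMeasure_empiricalLaw F hT
  have hQ := memLp_empiricalLaw F hT
  have hconj : ι.HolderConjugate q := ENNReal.holderConjugate_iff.2 (by simpa using hιq)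
  have hU : ∀ P ∈ U, ∀ k, MemLp (fun x : Fin K → ℝ => x k) 2 P := fun P hP =>
    memLp_of_mem_uncertaintySet (q := q) hδ hQ hP
  have risk (w : Fin p → ℝ) {P : Measure (Fin K → ℝ)} (hP : P ∈ U) :
      portfolioRisk B (covMat Pstar e) w P =
        Var[fun x => (Bᵀ *ᵥ w) ⬝ᵥ x; P] + w ⬝ᵥ (covMat Pstar e *ᵥ w) :=
    have := hP.1
    portfolioRisk_eq B (hU P hP) _ w
  have risk_le (w : Fin p → ℝ) {P : Measure (Fin K → ℝ)} (hP : P ∈ U) :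
      (portfolioRisk B (covMat Pstar e) w P : EReal) ≤ dual.objective w := by
    refine EReal.coe_le_coe_iff.2 ?_
    rw [risk w hP, dotProduct_conj_covMat B hQ]
    gcongr
    exact variance_le_of_mem_uncertaintySet hδ hQ hP _
  have risk_attained (w : Fin p → ℝ) :
      ∃ P ∈ U, (portfolioRisk B (covMat Pstar e) w P : EReal) = dual.objective w := by
    obtain ⟨P, hP, hvar⟩ := exists_variance_eq (q := q) (s := ι) hδ hQ (Bᵀ *ᵥ w)
    refine ⟨P, hP, congrArg _ ?_⟩
    rw [risk w hP, hvar, dotProduct_conj_covMat B hQ]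
  have le_return (w : Fin p → ℝ) {P : Measure (Fin K → ℝ)} (hP : P ∈ U) :
      w ⬝ᵥ (B *ᵥ meanVec (empiricalLaw F) id) - √δ * lpNormVec q (Bᵀ *ᵥ w) ≤
        portfolioReturn B w P := by
    rw [portfolioReturn_eq, dotProduct_mulVec_eq, ← integral_dotProduct (X := id) hQ]
    exact le_integral_of_mem_uncertaintySet hδ hQ hP _
  have return_attained (w : Fin p → ℝ) : ∃ P ∈ U, portfolioReturn B w P =
      w ⬝ᵥ (B *ᵥ meanVec (empiricalLaw F) id) - √δ * lpNormVec q (Bᵀ *ᵥ w) := by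
    obtain ⟨P, hP, hmean⟩ := exists_integral_eq (q := q) (s := ι) hδ hQ (Bᵀ *ᵥ w)
    refine ⟨P, hP, ?_⟩
    rw [portfolioReturn_eq, dotProduct_mulVec_eq, hmean]
    exact congrArg (· - _) (integral_dotProduct (X := id) hQ _)
  have hfeas : primal.feasible = dual.feasible := by
    ext w
    refine and_congr_right fun _ => ?_
    simp only [le_iInf_iff, EReal.coe_le_coe_iff]
    constructor
    · intro h
      -- Testing the robust constraint at the worst-case law alone gives the regularized one.
      obtain ⟨P, hP, hmin⟩ := return_attained w
      have := h P hP
      linarith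
    · intro h P hP
      have := le_return w hP
      linarith
  have hobj : ∀ w, primal.objective w = dual.objective w := by
    intro w
    obtain ⟨P, hP, hmax⟩ := risk_attained w
    exact le_antisymm (iSup₂_le fun P hP => risk_le w hP) (hmax ▸ le_iSup₂_of_le P hP le_rfl)
  refine ⟨hU, fun w => ⟨?_, ?_⟩, hfeas, hobj, ?_, ?_⟩
  · obtain ⟨P, hP, hmax⟩ := risk_attained w
    exact ⟨P, hP, fun P' hP' => EReal.coe_le_coe_iff.1 (hmax ▸ risk_le w hP')⟩
  · obtain ⟨P, hP, hmin⟩ := return_attained w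
    exact ⟨P, hP, fun P' hP' => hmin.le.trans (le_return w hP')⟩
  · simp only [MinProblem.value, hfeas, hobj]
  · simp only [MinProblem.solutions, hfeas, hobj]
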